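/- Let $X$ be a topological group with a $\sigma$-algebra and a measure $\mu$ on it such that at least one of the following holds: (i) $X$ is a measurable group (multiplication $X\times X\to X$ and inversion are measurable) and $\mu$ is $\sigma$-finite and left quasi-invariant: if $\mu(N)=0$ then $\mu(gN)=0$ for every $g\in X$ (for example, $\mu$ is a left-invariant $\sigma$-finite measure, or a probability measure with the same null sets as such a measure); (ii) $X$ is locally compact and $\mu$ is a (left or right) Haar measure, i.e. a regular Borel measure, finite on compact sets, positive on non-empty open sets, and left- (respectively right-) invariant. Let $\mathcal B$ be a differentiation basis for $\mu$: for every $x\in X$, a (non-trivial) notion of convergence $I\Rightarrow x$ of sets $I\subseteq X$ to $x$, given by a filter on the sets, for which the sets $I$ are eventually measurable, with $0<\mu(I)<\infty$, and contained in any given neighbourhood of $x$. Let $\mathcal D_\mu$ be the density topology generated by $\mu$ through $\mathcal B$: a set $U$ is $\mathcal D_\mu$-open if and only if every $x\in U$ is a density point of $U$, i.e. $\mu^*(I\setminus U)/\mu(I)\to 0$ as $I\Rightarrow x$, where $\mu^*$ is the outer measure of $\mu$. If $A\subseteq X$ is co-null (i.e. $\mu^*(X\setminus A)=0$) and $(z_n)_{n\in\mathbb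 N}$ is a null sequence in $X$ (i.e. $z_n\to 1_X$ in the group topology), then there is a set $H\subseteq A$ that is a $\mathcal G_\delta$ set for $\mathcal D_\mu$ and dense for $\mathcal D_\mu$, such that $a z_n\in A$ for all $a\in H$ and all $n\in\mathbb N$. -/

import Mathlib

open Filter Topology MeasureTheory

/-- A differentiation basis for a measure `μ` on a topological space: for every point `x`, a notion
`I ⇒ x` of convergence of sets `I` to `x`, recorded as a filter on sets (for a basis given by a
family of sequences of sets contracting to `x`, the supremum of the filters of their tails). The
sets that converge to `x` are eventually measurable, of positive and finite measure, and inside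
any prescribed neighbourhood of `x`. -/
structure DifferentiationBasis {X : Type*} [TopologicalSpace X] [MeasurableSpace X]
    (μ : Measure X) where
  conv : X → Filter (Set X)
  neBot : ∀ x, (conv x).NeBot
  measurableSet : ∀ x, ∀ᶠ I in conv x, MeasurableSet I
  measure_pos : ∀ x, ∀ᶠ I in conv x, 0 < μ I
  measure_lt_top : ∀ x, ∀ᶠ I in conv x, μ I < ⊤
  contracting : ∀ x, ∀ V ∈ 𝓝 x, ∀ᶠ I in conv x, I ⊆ V

namespace DifferentiationBasis

variable {X : Type*} [TopologicalSpace X] [MeasurableSpace X] {μ : Measure X}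

/-- `x` is a density point of `U`: the complement of `U` has (outer) density `0` at `x`. Here `μ` of
a set that need not be measurable is its outer measure. For measurable `U` this says that
`μ (I ∩ U) / μ I` tends to `1` as `I ⇒ x`. -/
def IsDensityPoint (B : DifferentiationBasis μ) (U : Set X) (x : X) : Prop :=
  Tendsto (fun I : Set X => μ (I \ U) / μ I) (B.conv x) (𝓝 0)

/-- The density topology generated by `μ` (through the basis `B`): a set is open when each of its
points is a density point of it. -/
@[reducible] def densityTopology (B : DifferentiationBasis μ) : TopologicalSpace X where
  IsOpen U := ∀ x ∈ U, B.IsDensityPoint U x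
  isOpen_univ := by
    intro x _
    simpa [IsDensityPoint] using tendsto_const_nhds
  isOpen_inter := by
    intro s t hs ht x hx
    have h := (hs x hx.1).add (ht x hx.2)
    rw [add_zero] at h
    refine tendsto_of_tendsto_of_tendsto_of_le_of_le tendsto_const_nhds h
      (fun _ => zero_le) (fun I => ?_)
    change μ (I \ (s ∩ t)) / μ I ≤ μ (I \ s) / μ I + μ (I \ t) / μ I
    rw [Set.sdiff_inter, ← ENNReal.add_div]
    exact ENNReal.div_le_div_right (measure_union_le _ _) _
  isOpen_sUnion := by
    intro S hS x hx
    obtain ⟨s, hs, hxs⟩ := hx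
    refine tendsto_of_tendsto_of_tendsto_of_le_of_le tendsto_const_nhds (hS s hs x hxs)
      (fun _ => zero_le) (fun I => ?_)
    exact ENNReal.div_le_div_right
      (measure_mono (Set.sdiff_subset_sdiff_right (Set.subset_sUnion_of_mem hs))) _

end DifferentiationBasis

/-- `X` with `μ` is a measurable group whose measure is `σ`-finite and left quasi-invariant:
multiplication and inversion are measurable, and left translations preserve null sets. A
left-invariant `σ`-finite measure, or a probability measure with the same null sets, is of this
kind. -/
def IsQuasiInvariantMeasurableGroup {X : Type*} [Group X] [MeasurableSpace X]
    (μ : Measure X) : Prop :=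
  MeasurableMul₂ X ∧ MeasurableInv X ∧ SigmaFinite μ ∧
    ∀ g : X, Measure.QuasiMeasurePreserving (fun x => g * x) μ μ

/-- `μ` is a (left or right) Haar measure on the locally compact group `X`: a regular Borel measure,
finite on compact sets, positive on nonempty open sets, and left-invariant (respectively
right-invariant, i.e. the image of a left Haar measure under inversion). -/
def IsHaarOnLocallyCompactGroup {X : Type*} [Group X] [TopologicalSpace X] [MeasurableSpace X]
    (μ : Measure X) : Prop :=
  LocallyCompactSpace X ∧ BorelSpace X ∧ μ.Regular ∧ (μ.IsHaarMeasure ∨ μ.inv.IsHaarMeasure)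

/-! Take `H` to be the set of `a ∈ A` with `a * z n ∈ A` for all `n`, a countable intersection of
right translates of `A`. If right translations preserve null sets, `H` is co-null. Co-null sets are
open in the density topology, and dense because null sets have no density points. Right
quasi-invariance comes from Fubini in the measurable group case, and from uniqueness of Haar measure
in the left Haar case. -/

/-- On a measurable group, inversion preserves the null sets of an s-finite left quasi-invariant
measure. -/
theorem quasiMeasurePreserving_inv_of_left_quasiInvariant {X : Type*} [Group X]
    [MeasurableSpace X] [MeasurableMul₂ X] [MeasurableInv X] (μ : Measure X) [SFinite μ]
    (h : ∀ g : X, Measure.QuasiMeasurePreserving (fun x => g * x) μ μ) :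
    Measure.QuasiMeasurePreserving (fun x : X => x⁻¹) μ μ := by
  refine ⟨measurable_inv, Measure.AbsolutelyContinuous.mk fun N hN hN0 => ?_⟩
  rw [Measure.map_apply measurable_inv hN]
  rcases eq_zero_or_neZero μ with rfl | hμ
  · simp
  -- The section of `S` over `x` is `xN`, which is null, so `S` is null. Slicing the other way,
  -- `xN⁻¹` is null for almost every `x`; as `μ ≠ 0`, one such `x` exists, and translating by it
  -- makes `N⁻¹` null.
  let S : Set (X × X) := (fun p : X × X => p.1⁻¹ * p.2) ⁻¹' N
  have hS : MeasurableSet S := (measurable_fst.inv.mul measurable_snd) hN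
  have hS0 : (μ.prod μ) S = 0 :=
    Measure.measure_prod_null_of_ae_null hS
      (Eventually.of_forall fun y => (h y⁻¹).preimage_null hN0)
  have hS1 : (μ.prod μ) (Prod.swap ⁻¹' S) = 0 :=
    Measure.measurePreserving_swap.quasiMeasurePreserving.preimage_null hS0
  obtain ⟨x, hx⟩ := (Measure.measure_ae_null_of_prod_null hS1).exists
  have hx' := (h x).preimage_null hx
  convert hx' using 2
  ext y
  simp [S]

/-- On a measurable group, right translations preserve the null sets of an s-finite left
quasi-invariant measure. -/
theorem quasiMeasurePreserving_mul_right_of_left_quasiInvariant {X : Type*} [Group X]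
    [MeasurableSpace X] [MeasurableMul₂ X] [MeasurableInv X] (μ : Measure X) [SFinite μ]
    (h : ∀ g : X, Measure.QuasiMeasurePreserving (fun x => g * x) μ μ) (g : X) :
    Measure.QuasiMeasurePreserving (fun x : X => x * g) μ μ := by
  have hi := quasiMeasurePreserving_inv_of_left_quasiInvariant μ h
  -- `x * g = (g⁻¹ * x⁻¹)⁻¹`.
  have hc := hi.comp ((h g⁻¹).comp hi)
  simpa [Function.comp_def] using hc

/-- Right translations preserve the null sets of a regular left Haar measure, without any
`σ`-finiteness assumption. -/
theorem quasiMeasurePreserving_mul_right_of_isHaarMeasure {X : Type*} [Group X]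
    [TopologicalSpace X] [IsTopologicalGroup X] [LocallyCompactSpace X] [MeasurableSpace X]
    [BorelSpace X] (μ : Measure X) [μ.IsHaarMeasure] [μ.Regular] (g : X) :
    Measure.QuasiMeasurePreserving (fun x : X => x * g) μ μ := by
  refine ⟨measurable_mul_const g, ?_⟩
  have : (Measure.map (fun x : X => x * g) μ).Regular :=
    Measure.Regular.map (Homeomorph.mulRight g)
  -- Left and right translations commute, so the pushforward is still left-invariant, hence a
  -- multiple of `μ`.
  rw [Measure.isMulLeftInvariant_eq_smul_of_regular (Measure.map (fun x : X => x * g) μ) μ]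
  exact Measure.smul_absolutelyContinuous

theorem quasiMeasurePreserving_mul_right_of_isHaarOnLocallyCompactGroup {X : Type*} [Group X]
    [TopologicalSpace X] [IsTopologicalGroup X] [MeasurableSpace X] {μ : Measure X}
    (hμ : IsHaarOnLocallyCompactGroup μ) (g : X) :
    Measure.QuasiMeasurePreserving (fun x : X => x * g) μ μ := by
  obtain ⟨_, _, _, hl | hr⟩ := hμ
  · exact quasiMeasurePreserving_mul_right_of_isHaarMeasure μ g
  · have : μ.IsMulRightInvariant := by
      rw [← μ.inv_inv]
      infer_instance
    exact (measurePreserving_mul_right μ g).quasiMeasurePreserving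

namespace DifferentiationBasis

variable {X : Type*} [TopologicalSpace X] [MeasurableSpace X] {μ : Measure X}

theorem isOpen_densityTopology_of_measure_compl_eq_zero (B : DifferentiationBasis μ) {H : Set X}
    (hH : μ Hᶜ = 0) : IsOpen[B.densityTopology] H := by
  intro x _
  have h0 (I : Set X) : μ (I \ H) = 0 := measure_mono_null (fun _ hy => hy.2) hH
  simpa [IsDensityPoint, h0] using tendsto_const_nhds

/-- A null set has no density points. -/
theorem not_isDensityPoint_of_measure_eq_zero (B : DifferentiationBasis μ) {U : Set X}
    (hU : μ U = 0) (x : X) : ¬ B.IsDensityPoint U x := by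
  intro h
  have := B.neBot x
  -- Removing a null set leaves the measure of `I` unchanged, so the ratio is eventually exactly
  -- `1`.
  have h1 : Tendsto (fun I : Set X => μ (I \ U) / μ I) (B.conv x) (𝓝 1) := by
    refine tendsto_const_nhds.congr' ?_
    filter_upwards [B.measure_pos x, B.measure_lt_top x] with I hpos hlt
    rw [measure_sdiff_null hU, ENNReal.div_self hpos.ne' hlt.ne]
  exact zero_ne_one (tendsto_nhds_unique h h1)

theorem dense_densityTopology_of_measure_compl_eq_zero (B : DifferentiationBasis μ) {H : Set X}
    (hH : μ Hᶜ = 0) : @Dense X B.densityTopology H := by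
  refine (@dense_iff_inter_open X B.densityTopology H).2 fun U hU ⟨x, hx⟩ => ?_
  by_contra hne
  refine B.not_isDensityPoint_of_measure_eq_zero (measure_mono_null ?_ hH) x (hU x hx)
  exact fun y hy hyH => hne ⟨y, hy, hyH⟩

end DifferentiationBasis

theorem mainTheorem8 {X : Type*} [Group X] [TopologicalSpace X] [IsTopologicalGroup X]
    [MeasurableSpace X] (μ : Measure X)
    (hμ : IsQuasiInvariantMeasurableGroup μ ∨ IsHaarOnLocallyCompactGroup μ)
    (B : DifferentiationBasis μ)
    (A : Set X) (hA : μ Aᶜ = 0)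
    (z : ℕ → X) (hz : Tendsto z atTop (𝓝 1)) :
    ∃ H : Set X, @IsGδ X B.densityTopology H ∧ @Dense X B.densityTopology H ∧
      H ⊆ A ∧ ∀ a ∈ H, ∀ n : ℕ, a * z n ∈ A := by
  have hright (g : X) : Measure.QuasiMeasurePreserving (fun x : X => x * g) μ μ := by
    rcases hμ with ⟨_, _, _, hl⟩ | hμ
    · exact quasiMeasurePreserving_mul_right_of_left_quasiInvariant μ hl g
    · exact quasiMeasurePreserving_mul_right_of_isHaarOnLocallyCompactGroup hμ g
  have hH : μ (A ∩ ⋂ n, (fun x => x * z n) ⁻¹' A)ᶜ = 0 := by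
    rw [Set.compl_inter, Set.compl_iInter, measure_union_null_iff, measure_iUnion_null_iff]
    exact ⟨hA, fun n => (hright (z n)).preimage_null hA⟩
  exact ⟨_, @IsOpen.isGδ X B.densityTopology _
      (B.isOpen_densityTopology_of_measure_compl_eq_zero hH),
    B.dense_densityTopology_of_measure_compl_eq_zero hH, Set.inter_subset_left,
    fun a ha n => Set.mem_iInter.1 ha.2 n⟩
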